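/- Let $K$ be a field, $n\ge 0$ an integer, $A=(a_{i,j})_{1\le i,j\le n}$ an $n\times n$ matrix over $K$, and $\lambda=(\lambda_a)_{a\in\mathbb Z}$, $\mu=(\mu_a)_{a\in\mathbb Z}$ sequences in $K$. The generalized Lambda-determinant of $A$ is $|A|_{\lambda,\mu}=T_{0,0,n}$, where $T_{i,j,k}$ ($i+j+k\equiv n \bmod 2$, $k\ge 0$, $|i|+|j|+k\le n$) is the solution of $$T_{i,j,k+1}T_{i,j,k-1}=\mu_j\,T_{i,j+1,k}T_{i,j-1,k}+\lambda_i\,T_{i+1,j,k}T_{i-1,j,k},\qquad T_{i,j,0}=1,\quad T_{i,j,1}=a_{\frac{j-i+n+1}{2},\frac{i+j+n+1}{2}} .$$ Assume that this definition makes sense, i.e. that every $T_{i,j,k}$ with $|i|+|j|+k\le n-2$ and $i+j+k\equiv n \bmod 2$ is nonzero (these are the quantities by which the recursion divides), and that the matrix entries occurring as denominators in the network below, $a_{i,j}$ with $2\le i\le n$, are nonzero. Let $\hat G_{min}(n)$ be the following weighted directed network. Its vertices are the points $(x,y)\in\mathbb Z^2$ with $x+y$ even and $|x|+|y-n+1|\le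 n-1$. Put $\alpha_{x,y}=a_{\frac{x-y}{2}+n,\frac{x+y}{2}+1}$. Whenever both end points are vertices, there are * an up edge $(x,y)\to(x+1,y+1)$ of weight $\lambda_{y+1-n}$, provided that $x<y$; * a horizontal edge $(x,y)\to(x+2,y)$ of weight $\mu_{x+1}\,\alpha_{x,y}/\alpha_{x+1,y-1}$; * a down edge $(x,y)\to(x+1,y-1)$ of weight $\alpha_{x,y}/\alpha_{x+1,y-1}$, provided that $-x<y$. The weight of a directed path is the product of the weights of its edges (and $1$ for a path consisting of one vertex). For $1\le i\le 2n-1$ the $i$-th entry (exit) vertex is the leftmost (rightmost) vertex at height $y=i-1$; for $i\le n$ these are the SW vertices $(1-i,i-1)$ and the SE vertices $(i-1,i-1)$. Let $\hat\Theta_{min}(n)$ be the $(2n-1)\times(2n-1)$ matrix whose $(i,j)$ entry is the sum of the weights of all directed paths from the $i$-th entry vertex to the $j$-th exit vertex, and let $\hat a_{min}(n)$ be its principal minor on the first $n$ rows and columns. (For $n=0$ the network and the matrices are empty and the minor is $1$.) Then $$|A|_{\lambda,\mu}=\hat a_{min}(n)\prod_{j=1}^n a_{n,j},$$ and also $$|A|_{\lambda,\mu}=\hat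 Z_n\prod_{j=1}^n a_{n,j},$$ where $\hat Z_n$ is the partition function of the families of $n$ non-intersecting (pairwise vertex-disjoint) directed paths on $\hat G_{min}(n)$ starting at the $n$ SW vertices, one from each, and ending at SE vertices: the sum over all such families of the product of the weights of the $n$ paths. -/

import Mathlib

noncomputable section

namespace LambdaDet

variable {K : Type*} [Field K] {n : ℕ}

/-- The entry `a_{r,c}` of `A`, with the rows and columns numbered `1, …, n` by integers
(and `0` outside of this range, where it is never used below). -/
def entry (A : Matrix (Fin n) (Fin n) K) (r c : ℤ) : K :=
  if h : (1 ≤ r ∧ r ≤ n) ∧ (1 ≤ c ∧ c ≤ n) then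
    A ⟨(r - 1).toNat, by omega⟩ ⟨(c - 1).toNat, by omega⟩
  else 0

/-- `T A lam mu k i j` is the solution `T_{i,j,k}` of the inhomogeneous `T`-system
`T_{i,j,k+1} T_{i,j,k-1} = μ_j T_{i,j+1,k} T_{i,j-1,k} + λ_i T_{i+1,j,k} T_{i-1,j,k}`
with initial data `T_{i,j,0} = 1` and `T_{i,j,1} = a_{(j-i+n+1)/2, (i+j+n+1)/2}`.
Only the values with `i + j + k ≡ n` modulo `2` and `|i| + |j| + k ≤ n` are meaningful. -/
def T (A : Matrix (Fin n) (Fin n) K) (lam mu : ℤ → K) : ℕ → ℤ → ℤ → K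
  | 0, _, _ => 1
  | 1, i, j => entry A ((j - i + n + 1) / 2) ((i + j + n + 1) / 2)
  | k + 2, i, j =>
      (mu j * T A lam mu (k + 1) i (j + 1) * T A lam mu (k + 1) i (j - 1)
        + lam i * T A lam mu (k + 1) (i + 1) j * T A lam mu (k + 1) (i - 1) j)
      / T A lam mu k i j

/-- The generalized Lambda-determinant `|A|_{λ,μ} = T_{0,0,n}`. -/
def lambdaDet (A : Matrix (Fin n) (Fin n) K) (lam mu : ℤ → K) : K :=
  T A lam mu n 0 0

/-- The definition of `|A|_{λ,μ}` makes sense: every `T_{i,j,k}` by which one divides in the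
computation of `T_{0,0,n}` is nonzero. -/
def IsDefined (A : Matrix (Fin n) (Fin n) K) (lam mu : ℤ → K) : Prop :=
  ∀ (k : ℕ) (i j : ℤ), (i + j + k) % 2 = (n : ℤ) % 2 → |i| + |j| + k + 2 ≤ n →
    T A lam mu k i j ≠ 0

/-- The vertices of the network: the points `(x, y)` of the diamond
`|x| + |y - n + 1| ≤ n - 1` with `x + y` even. -/
def InDiamond (n : ℕ) (p : ℤ × ℤ) : Prop :=
  (p.1 + p.2) % 2 = 0 ∧ |p.1| + |p.2 - n + 1| ≤ (n : ℤ) - 1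

/-- The label `a_{(x-y)/2+n, (x+y)/2+1}` of the down-pointing triangle with bottom
vertex `(x, y)`. -/
def label (A : Matrix (Fin n) (Fin n) K) (p : ℤ × ℤ) : K :=
  entry A ((p.1 - p.2) / 2 + n) ((p.1 + p.2) / 2 + 1)

/-- The directed edges of the network `Ĝ_min(n)`: up, horizontal and down edges of the triangular
lattice, from left to right. The concatenation of chips that defines the network
has no down edge along the SW border `x = -y` and no up edge along the SE border `x = y`; in
particular the bottom vertex `(0, 0)` is isolated. -/
def Edge (n : ℕ) (u v : ℤ × ℤ) : Prop :=
  InDiamond n u ∧ InDiamond n v ∧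
    ((v = (u.1 + 1, u.2 + 1) ∧ u.1 < u.2) ∨
      v = (u.1 + 2, u.2) ∨
      (v = (u.1 + 1, u.2 - 1) ∧ -u.1 < u.2))

/-- The weight of the edge from `u = (x, y)` to `v`: it is `λ_{y+1-n}` for an up edge,
`μ_{x+1} α_{x,y} / α_{x+1,y-1}` for a horizontal edge, and `α_{x,y} / α_{x+1,y-1}` for a down
edge, where `α` denotes the label. -/
def edgeWeight (A : Matrix (Fin n) (Fin n) K) (lam mu : ℤ → K) (u v : ℤ × ℤ) : K :=
  if v = (u.1 + 1, u.2 + 1) then lam (u.2 + 1 - n)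
  else if v = (u.1 + 2, u.2) then mu (u.1 + 1) * (label A u / label A (u.1 + 1, u.2 - 1))
  else label A u / label A (u.1 + 1, u.2 - 1)

/-- `l` is the list of successive vertices of a directed path from `u` to `v` (a single vertex is
a path from itself to itself). -/
def IsPath (n : ℕ) (u v : ℤ × ℤ) (l : List (ℤ × ℤ)) : Prop :=
  (∀ p ∈ l, InDiamond n p) ∧ l.IsChain (Edge n) ∧ l.head? = some u ∧ l.getLast? = some v

/-- The directed paths from `u` to `v` on the network. -/
def Path (n : ℕ) (u v : ℤ × ℤ) : Type :=
  {l : List (ℤ × ℤ) // IsPath n u v l}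

/-- The product of the weights of the edges between successive vertices of a list. -/
def listWeight (A : Matrix (Fin n) (Fin n) K) (lam mu : ℤ → K) : List (ℤ × ℤ) → K
  | [] => 1
  | [_] => 1
  | u :: v :: l => edgeWeight A lam mu u v * listWeight A lam mu (v :: l)

theorem finite_inDiamond (n : ℕ) : {p : ℤ × ℤ | InDiamond n p}.Finite := by
  apply (Set.finite_Icc ((-(n : ℤ), -(n : ℤ)) : ℤ × ℤ) ((n : ℤ), 2 * (n : ℤ))).subset
  rintro ⟨x, y⟩ ⟨-, h⟩
  simp only [Set.mem_Icc, Prod.le_def]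
  simp only at h
  have h1 := abs_le.1 (le_refl |x|)
  have h2 := abs_le.1 (le_refl |y - n + 1|)
  omega

theorem IsPath.nodup {u v : ℤ × ℤ} {l : List (ℤ × ℤ)} (h : IsPath n u v l) : l.Nodup := by
  have h1 : l.IsChain (fun a b => a.1 < b.1) := h.2.1.imp (by
    rintro a b ⟨-, -, ⟨rfl, -⟩ | rfl | ⟨rfl, -⟩⟩ <;> simp)
  have : IsTrans (ℤ × ℤ) (fun a b => a.1 < b.1) := ⟨fun a b c => lt_trans⟩
  exact (List.isChain_iff_pairwise.1 h1).imp (fun {a b} hab => by rintro rfl; exact lt_irrefl _ hab)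

instance instFinitePath (u v : ℤ × ℤ) : Finite (Path n u v) := by
  have : Fintype {p : ℤ × ℤ // InDiamond n p} := (finite_inDiamond n).fintype
  let f : Path n u v → {l : List {p : ℤ × ℤ // InDiamond n p} // l.Nodup} := fun l =>
    ⟨l.1.attach.map fun p => ⟨p.1, l.2.1 p.1 p.2⟩, by
      refine (List.nodup_attach.2 l.2.nodup).map ?_
      intro a b hab
      exact Subtype.ext (congrArg (fun q => q.1) hab)⟩
  classical
  refine Finite.of_injective f ?_
  intro a b hab
  have h := congrArg (fun q => q.1.map Subtype.val) hab
  simp only [f, List.map_map, Function.comp_def, List.attach_map_subtype_val] at h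
  exact Subtype.ext h

instance instFintypePath (u v : ℤ × ℤ) : Fintype (Path n u v) := Fintype.ofFinite _

/-- The entry vertex of the network at height `y`, on the left (SW or NW) border;
for `y < n` it is the SW vertex `(-y, y)`. -/
def leftVertex (n : ℕ) (y : ℤ) : ℤ × ℤ := (-((n : ℤ) - 1 - |y - n + 1|), y)

/-- The exit vertex of the network at height `y`, on the right (SE or NE) border;
for `y < n` it is the SE vertex `(y, y)`. -/
def rightVertex (n : ℕ) (y : ℤ) : ℤ × ℤ := ((n : ℤ) - 1 - |y - n + 1|, y)

/-- The matrix `Θ̂_min(n)` of the network, of size `2n - 1`: its entry `(i, j)` is the sum over the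
directed paths from the `i`-th entry vertex to the `j`-th exit vertex (both counted from the bottom)
of the product of the edge weights. -/
def thetaHat (A : Matrix (Fin n) (Fin n) K) (lam mu : ℤ → K) :
    Matrix (Fin (2 * n - 1)) (Fin (2 * n - 1)) K :=
  Matrix.of fun i j =>
    ∑ p : Path n (leftVertex n (i : ℕ)) (rightVertex n (j : ℕ)), listWeight A lam mu p.1

/-- The principal minor `â_min(n)` of `Θ̂_min(n)` on the first `n` rows and columns. -/
def aHat (A : Matrix (Fin n) (Fin n) K) (lam mu : ℤ → K) : K :=
  ((thetaHat A lam mu).submatrix (Fin.castLE (by omega : n ≤ 2 * n - 1))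
    (Fin.castLE (by omega : n ≤ 2 * n - 1))).det

/-- The families of `n` non-intersecting (pairwise vertex-disjoint) directed paths, one from each of
the `n` SW vertices `(-i, i)`, each ending at one of the `n` SE vertices `(j, j)`. -/
def NonIntersecting (n : ℕ) : Type :=
  {f : (i : Fin n) → Σ j : Fin n, Path n (-((i : ℕ) : ℤ), ((i : ℕ) : ℤ)) (((j : ℕ) : ℤ), ((j : ℕ) : ℤ)) //
    ∀ i i' : Fin n, i ≠ i' → List.Disjoint (f i).2.1 (f i').2.1}

instance instFintypeNonIntersecting : Fintype (NonIntersecting n) :=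
  have : Finite (NonIntersecting n) := Subtype.finite
  Fintype.ofFinite _

/-- The partition function of the families of `n` non-intersecting paths. -/
def partitionFunction (A : Matrix (Fin n) (Fin n) K) (lam mu : ℤ → K) : K :=
  ∑ f : NonIntersecting n, ∏ i : Fin n, listWeight A lam mu (f.1 i).2.1

end LambdaDet

end

noncomputable section

namespace LambdaDet

/-! In the coordinates `u = (x + y) / 2`, `v = (y - x) / 2` the network lives on a quarter plane: up
edges raise `u`, down edges lower `v`, horizontal edges do both, and the steps along the two axes
are removed. SW vertices are the points `(0, i)`, SE vertices the points `(j, 0)`. Let `P(u, v, k)`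
be the `k × k` path determinant (`pathDet`) of the network with origin moved to `(u, v)`. The core
is that `P(u, v, k)`, multiplied by the `k` labels `cell A (u + i) v`, equals `T_{i,j,k}` at `i = u
+ v + k - n`, `j = u - v` (`T_eq_pathDet_mul_prod`); taking `u = v = 0` and `k = n` gives the
theorem for the minor.

This holds by induction because `P` satisfies a condensation recurrence of the same shape as the
`T`-system (`pathDet_add_two_mul`). Cutting paths along `u = 1` and `v = 1` writes the path matrix,
without its trivial first row and column, as `X * Q * Y` plus a corner term: `X` is lower
triangular, `Y` upper triangular, `Q` the path matrix of the network shifted by `(1, 1)`, and the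
corner is the diagonal step `(0, 1) → (1, 0)`. Desnanot–Jacobi for `X * (Q * Y)`
(`desnanot_jacobi_mul`) then yields the recurrence.

The partition function is the same determinant by Lindström–Gessel–Viennot (`det_sum_paths_eq`):
intersecting families cancel under exchange of tails, and planarity (`le_of_disjoint_paths`) forces
the identity permutation on the others, so every sign is `+1`. -/

/-! ### Determinant identities -/

/-- The decomposition of `Fin (m + 2)` into its interior and its two end points. -/
def interiorEndsEquiv (m : ℕ) : Fin m ⊕ Fin 2 ≃ Fin (m + 2) :=
  Equiv.ofBijective (Sum.elim (fun i => i.castSucc.succ) ![0, Fin.last (m + 1)]) <| by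
    rw [Fintype.bijective_iff_injective_and_card]
    refine ⟨?_, by simp⟩
    rintro (i | i) (j | j) h
    · simpa [Fin.ext_iff] using h
    · fin_cases j <;> simp [Fin.ext_iff] at h <;> omega
    · fin_cases i <;> simp [Fin.ext_iff] at h <;> omega
    · fin_cases i <;> fin_cases j <;> simp [Fin.ext_iff] at h ⊢

/-- The Desnanot–Jacobi identity for matrices with nonzero determinant. -/
theorem desnanot_jacobi_of_det_ne_zero {R : Type*} [CommRing R] [IsDomain R] {m : ℕ}
    (M : Matrix (Fin (m + 2)) (Fin (m + 2)) R) (hM : M.det ≠ 0) :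
    M.det * (M.submatrix (fun i : Fin m => i.castSucc.succ) (fun i : Fin m => i.castSucc.succ)).det =
      (M.submatrix Fin.succ Fin.succ).det * (M.submatrix Fin.castSucc Fin.castSucc).det -
        (M.submatrix Fin.castSucc Fin.succ).det * (M.submatrix Fin.succ Fin.castSucc).det := by
  set e := interiorEndsEquiv m
  have e1 : ∀ i, e (Sum.inl i) = i.castSucc.succ := fun i => rfl
  have e2 : e (Sum.inr 0) = 0 := rfl
  have e3 : e (Sum.inr 1) = Fin.last _ := rfl
  set M' := M.submatrix e e with hM'
  have hdet : M'.det = M.det := Matrix.det_submatrix_equiv_self e M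
  have hadj : M'.adjugate = M.adjugate.submatrix e e := Matrix.adjugate_submatrix_equiv_self e M
  -- Jacobi's trick: only the last two columns of the adjugate are kept, the others being replaced
  -- by identity columns. Taking determinants leaves the `2 × 2` minor of the adjugate on the left
  -- and `det²` times the interior minor on the right; one factor `det M` is then cancelled.
  have h1 : M' * Matrix.fromBlocks 1 M'.adjugate.toBlocks₁₂ 0 M'.adjugate.toBlocks₂₂ =
      Matrix.fromBlocks M'.toBlocks₁₁ 0 M'.toBlocks₂₁ (M'.det • 1) := by
    have h := Matrix.mul_adjugate M'
    rw [← Matrix.fromBlocks_toBlocks M'.adjugate] at h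
    nth_rw 1 [← Matrix.fromBlocks_toBlocks M'] at h
    nth_rw 1 [← Matrix.fromBlocks_toBlocks M']
    rw [Matrix.fromBlocks_multiply, ← Matrix.fromBlocks_one, Matrix.fromBlocks_smul,
      Matrix.fromBlocks_inj] at h
    rw [Matrix.fromBlocks_multiply]
    simp [h.2.1, h.2.2.2]
  have h2 := congrArg Matrix.det h1
  rw [Matrix.det_mul, Matrix.det_fromBlocks_zero₂₁, Matrix.det_fromBlocks_zero₁₂, Matrix.det_one,
    one_mul, Matrix.det_smul, Matrix.det_one, Matrix.det_fin_two, hdet, hadj] at h2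
  have hsub : M'.toBlocks₁₁ =
      M.submatrix (fun i : Fin m => i.castSucc.succ) (fun i : Fin m => i.castSucc.succ) := rfl
  rw [hsub] at h2
  simp only [Matrix.toBlocks₂₂, Matrix.of_apply, Matrix.submatrix_apply, e2, e3,
    Matrix.adjugate_fin_succ_eq_det_submatrix] at h2
  have z1 : (Fin.succAbove (0 : Fin (m + 2))) = Fin.succ := by ext i; simp
  have z2 : (Fin.succAbove (Fin.last (m + 1))) = Fin.castSucc := by ext i; simp
  simp only [z1, z2] at h2
  apply mul_left_cancel₀ hM
  have hs : ((-1 : R) ^ (m + 1)) * (-1) ^ (m + 1) = 1 := by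
    rw [← mul_pow]; simp
  simp only [Fin.val_zero, Fin.val_last, add_zero, zero_add, pow_zero, pow_add _ (m + 1) (m + 1),
    one_mul, Fintype.card_fin, mul_one] at h2
  linear_combination -h2 + M.det * (- (M.submatrix Fin.castSucc Fin.succ).det *
     (M.submatrix Fin.succ Fin.castSucc).det + (M.submatrix Fin.succ Fin.succ).det *
     (M.submatrix Fin.castSucc Fin.castSucc).det) * hs

theorem submatrix_castSucc_mul_of_isLower {R : Type*} [CommRing R] {m : ℕ} {ι : Type*}
    (X Y : Matrix (Fin (m + 1)) (Fin (m + 1)) R) (hX : ∀ i j, i < j → X i j = 0)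
    (c : ι → Fin (m + 1)) :
    (X * Y).submatrix Fin.castSucc c =
      X.submatrix Fin.castSucc Fin.castSucc * Y.submatrix Fin.castSucc c := by
  ext i j
  simp [Matrix.mul_apply, Fin.sum_univ_castSucc, hX _ _ (Fin.castSucc_lt_last i)]

theorem submatrix_mul_castSucc_of_isUpper {R : Type*} [CommRing R] {m : ℕ} {ι : Type*}
    (X Y : Matrix (Fin (m + 1)) (Fin (m + 1)) R) (hY : ∀ i j, j < i → Y i j = 0)
    (c : ι → Fin (m + 1)) :
    (X * Y).submatrix c Fin.castSucc =
      X.submatrix c Fin.castSucc * Y.submatrix Fin.castSucc Fin.castSucc := by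
  ext i j
  simp [Matrix.mul_apply, Fin.sum_univ_castSucc, hY _ _ (Fin.castSucc_lt_last j)]

theorem det_of_isLower {R : Type*} [CommRing R] {m : ℕ}
    (X : Matrix (Fin m) (Fin m) R) (hX : ∀ i j, i < j → X i j = 0) :
    X.det = ∏ i, X i i :=
  Matrix.det_of_isLowerTriangular X fun i j h => hX i j h

theorem det_of_isUpper {R : Type*} [CommRing R] {m : ℕ}
    (X : Matrix (Fin m) (Fin m) R) (hX : ∀ i j, j < i → X i j = 0) :
    X.det = ∏ i, X i i :=
  Matrix.det_of_isUpperTriangular (M := X) fun i j h => hX i j h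

/-- Since `X` is lower triangular, each minor of `X * Y` on the top rows factors through the leading
block of `X`. The determinant of this block divides every term of Desnanot–Jacobi and can be
cancelled when `X` is nonsingular. -/
theorem desnanot_jacobi_mul_of_det_ne_zero {R : Type*} [CommRing R] [IsDomain R] {m : ℕ}
    (X Y : Matrix (Fin (m + 2)) (Fin (m + 2)) R) (hX : ∀ i j, i < j → X i j = 0)
    (hX0 : X.det ≠ 0) (hY0 : Y.det ≠ 0) :
    ((X * Y).submatrix Fin.succ Fin.succ).det * (Y.submatrix Fin.castSucc Fin.castSucc).det =
      X (Fin.last _) (Fin.last _) * Y.det * ((X * Y).submatrix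
        (fun i : Fin m => i.castSucc.succ) (fun i : Fin m => i.castSucc.succ)).det +
      (Y.submatrix Fin.castSucc Fin.succ).det * ((X * Y).submatrix Fin.succ Fin.castSucc).det := by
  have h := desnanot_jacobi_of_det_ne_zero (X * Y) (by rw [Matrix.det_mul]; exact mul_ne_zero hX0 hY0)
  rw [submatrix_castSucc_mul_of_isLower X Y hX, submatrix_castSucc_mul_of_isLower X Y hX,
    Matrix.det_mul, Matrix.det_mul, Matrix.det_mul] at h
  have hd : X.det = (X.submatrix Fin.castSucc Fin.castSucc).det * X (Fin.last _) (Fin.last _) := by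
    rw [det_of_isLower X hX, det_of_isLower (X.submatrix Fin.castSucc Fin.castSucc)
      fun i j hij => hX i.castSucc j.castSucc (by simpa using hij),
      Fin.prod_univ_castSucc]
    rfl
  rw [hd] at h hX0
  apply mul_left_cancel₀ (left_ne_zero_of_mul hX0)
  linear_combination -h

/-- A Desnanot–Jacobi identity for a product `X * Y` with `X` lower triangular, in which the
common factor of all terms has been cancelled. -/
theorem desnanot_jacobi_mul {K : Type*} [Field K] {m : ℕ}
    (X Y : Matrix (Fin (m + 2)) (Fin (m + 2)) K) (hX : ∀ i j, i < j → X i j = 0) :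
    ((X * Y).submatrix Fin.succ Fin.succ).det * (Y.submatrix Fin.castSucc Fin.castSucc).det =
      X (Fin.last _) (Fin.last _) * Y.det * ((X * Y).submatrix
        (fun i : Fin m => i.castSucc.succ) (fun i : Fin m => i.castSucc.succ)).det +
      (Y.submatrix Fin.castSucc Fin.succ).det * ((X * Y).submatrix Fin.succ Fin.castSucc).det := by
  -- The characteristic matrices are `t + X` and `t + Y` over `K[t]`, with monic, hence nonzero,
  -- determinants; `t = 0` gives back `X` and `Y`.
  have h := desnanot_jacobi_mul_of_det_ne_zero (-X).charmatrix (-Y).charmatrix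
    (fun i j hij => by simp [Matrix.charmatrix_apply_ne _ _ _ hij.ne, hX i j hij])
    (-X).charpoly_monic.ne_zero (-Y).charpoly_monic.ne_zero
  have hev : ∀ Z : Matrix (Fin (m + 2)) (Fin (m + 2)) K,
      (-Z).charmatrix.map (Polynomial.evalRingHom (0 : K)) = Z := by
    intro Z
    ext i j
    by_cases hij : i = j
    · subst hij; simp
    · simp [Matrix.charmatrix_apply_ne _ _ _ hij]
  have h' := congrArg (Polynomial.evalRingHom (0 : K)) h
  have hl := congrFun (congrFun (hev X) (Fin.last _)) (Fin.last _)
  rw [Matrix.map_apply] at hl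
  simpa only [map_mul, map_add, RingHom.map_det, RingHom.mapMatrix_apply, Matrix.submatrix_map,
    ← Matrix.submatrix_map, Matrix.map_mul, hev, hl] using h'

/-! ### Path sums on the quarter plane -/

/-- The step weights of a directed network on `ℕ × ℕ`: `h u v` is the weight of the step
`(u, v) → (u + 1, v)`, `w u v` that of `(u, v + 1) → (u, v)`, and `d u v` that of
`(u, v + 1) → (u + 1, v)`. -/
structure StepWeights (K : Type*) where
  h : ℕ → ℕ → K
  w : ℕ → ℕ → K
  d : ℕ → ℕ → K

namespace StepWeights

variable {K : Type*} [Field K]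

/-- The weights of the network seen from `(a, b)`. -/
def shift (W : StepWeights K) (a b : ℕ) : StepWeights K where
  h u v := W.h (u + a) (v + b)
  w u v := W.w (u + a) (v + b)
  d u v := W.d (u + a) (v + b)

/-- The weighted number of paths from `(u, v)` to `(j, 0)` on the network in which the steps `h`
along `v = 0` and the steps `w` along `u = 0` are removed. -/
def pathSum (W : StepWeights K) (j : ℕ) (u v : ℕ) : K :=
  match v with
  | 0 => if u = j then 1 else 0
  | v + 1 =>
    if j < u then 0
    else W.h u (v + 1) * pathSum W j (u + 1) (v + 1) + W.d u v * pathSum W j (u + 1) v +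
      if u = 0 then 0 else W.w u v * pathSum W j u v
termination_by (v, j + 1 - u)

theorem pathSum_zero (W : StepWeights K) (j u : ℕ) :
    W.pathSum j u 0 = if u = j then 1 else 0 := by
  rw [pathSum]

theorem pathSum_of_lt (W : StepWeights K) {j u : ℕ} (hu : j < u) (v : ℕ) :
    W.pathSum j u v = 0 := by
  cases v with
  | zero => rw [pathSum_zero, if_neg hu.ne']
  | succ v => rw [pathSum, if_pos hu]

theorem pathSum_succ (W : StepWeights K) (j u v : ℕ) :
    W.pathSum j u (v + 1) =
      W.h u (v + 1) * W.pathSum j (u + 1) (v + 1) + W.d u v * W.pathSum j (u + 1) v +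
        if u = 0 then 0 else W.w u v * W.pathSum j u v := by
  by_cases hu : j < u
  · simp [pathSum_of_lt W hu, pathSum_of_lt W (Nat.lt_succ_of_lt hu)]
  · rw [pathSum, if_neg hu]

theorem pathSum_zero_zero_succ (W : StepWeights K) (v : ℕ) : W.pathSum 0 0 (v + 1) = 0 := by
  rw [pathSum_succ]; simp [pathSum_of_lt W Nat.zero_lt_one]

/-- The paths with weights `W` in the region `1 ≤ u` are the paths with shifted weights, apart from
the steps along the line `u = 1`. -/
theorem pathSum_shift_one_zero (W : StepWeights K) (j u v : ℕ) :
    (W.shift 1 0).pathSum j (u + 1) v = W.pathSum (j + 1) (u + 2) v := by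
  induction v generalizing u with
  | zero => simp [pathSum_zero]
  | succ v ih =>
    induction hk : j + 1 - u generalizing u with
    | zero => rw [pathSum_of_lt _ (by omega), pathSum_of_lt _ (by omega)]
    | succ k ihk =>
      rw [pathSum_succ (W.shift 1 0), pathSum_succ W, ih, ih, ihk (u + 1) (by omega)]
      simp [shift]

/-- The weighted number of paths from `(u, 1)` to `(j, 0)`, including the step `w` along `u = 0`. -/
def rowStep (W : StepWeights K) (j : ℕ) (u : ℕ) : K :=
  if j < u then 0
  else W.h u 1 * rowStep W j (u + 1) + (W.d u 0 * if u + 1 = j then 1 else 0) +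
    W.w u 0 * if u = j then 1 else 0
termination_by j + 1 - u

theorem rowStep_of_lt (W : StepWeights K) {j u : ℕ} (hu : j < u) : W.rowStep j u = 0 := by
  rw [rowStep, if_pos hu]

theorem rowStep_self (W : StepWeights K) (j : ℕ) : W.rowStep j j = W.w j 0 := by
  rw [rowStep, if_neg (lt_irrefl j), rowStep_of_lt W (Nat.lt_succ_self j)]
  simp

/-- The extra step `w` along `u = 0` only leads to `(0, 0)`, a dead end when the target is `(j, 0)`
with `j > 0`. -/
theorem pathSum_one (W : StepWeights K) {j : ℕ} (hj : 0 < j) (u : ℕ) :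
    W.pathSum j u 1 = W.rowStep j u := by
  induction hk : j + 1 - u generalizing u with
  | zero => rw [pathSum_of_lt _ (by omega), rowStep_of_lt _ (by omega)]
  | succ k ih =>
    rw [pathSum_succ, rowStep, if_neg (show ¬j < u by omega), ih (u + 1) (by omega), pathSum_zero,
      pathSum_zero]
    congr 1
    split_ifs <;> first | omega | simp

/-- Cutting the paths where they reach the line `v = 1`. -/
theorem pathSum_eq_sum_shift_zero_one (W : StepWeights K) {j N : ℕ} (hj : 0 < j) (hN : j < N)
    (u v : ℕ) :
    W.pathSum j u (v + 1) =
      ∑ k ∈ Finset.range N, (W.shift 0 1).pathSum k u v * W.rowStep j k := by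
  induction v generalizing u with
  | zero =>
    rw [pathSum_one W hj]
    simp only [pathSum_zero, ite_mul, one_mul, zero_mul, Finset.sum_ite_eq, Finset.mem_range]
    split_ifs with h
    · rfl
    · rw [rowStep_of_lt W (by omega)]
  | succ v ih =>
    induction hk : j + 1 - u generalizing u with
    | zero =>
      rw [pathSum_of_lt _ (by omega), eq_comm]
      refine Finset.sum_eq_zero fun k _ => ?_
      by_cases hjk : j < k
      · rw [rowStep_of_lt W hjk, mul_zero]
      · rw [pathSum_of_lt _ (by omega), zero_mul]
    | succ k ihk =>
      rw [pathSum_succ, ih, ih, ihk (u + 1) (by omega)]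
      have hs := fun l => pathSum_succ (W.shift 0 1) l u v
      simp only [hs, add_mul, Finset.sum_add_distrib, Finset.mul_sum]
      congr 1
      · simp only [shift, mul_assoc, add_zero]
      · split_ifs
        · simp
        · simp only [shift, mul_assoc, add_zero]

/-- The product of the steps `w` from `(1, v + 1)` down to `(1, k + 1)`. -/
def slide (W : StepWeights K) : ℕ → ℕ → K
  | 0, k => if k = 0 then 1 else 0
  | v + 1, k => (if k = v + 1 then 1 else 0) + W.w 1 (v + 1) * slide W v k

theorem slide_of_lt (W : StepWeights K) {v k : ℕ} (h : v < k) : W.slide v k = 0 := by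
  induction v with
  | zero => rw [slide, if_neg h.ne']
  | succ v ih => rw [slide, if_neg h.ne', ih (by omega)]; simp

theorem slide_self (W : StepWeights K) (v : ℕ) : W.slide v v = 1 := by
  cases v with
  | zero => simp [slide]
  | succ v => simp [slide, slide_of_lt W (Nat.lt_succ_self v)]

/-- The weighted number of paths from `(0, i + 1)` to `(1, k + 1)`. -/
def columnStep (W : StepWeights K) (i k : ℕ) : K :=
  W.h 0 (i + 1) * W.slide i k + if i = 0 then 0 else W.d 0 i * W.slide (i - 1) k

theorem columnStep_of_lt (W : StepWeights K) {i k : ℕ} (h : i < k) : W.columnStep i k = 0 := by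
  rw [columnStep, slide_of_lt W h, slide_of_lt W (by omega : i - 1 < k)]
  simp

theorem columnStep_self (W : StepWeights K) (i : ℕ) : W.columnStep i i = W.h 0 (i + 1) := by
  rw [columnStep, slide_self]
  split_ifs with h
  · simp
  · rw [slide_of_lt W (by omega)]; simp

/-- The weighted number of paths from `(1, k + 1)` to `(j + 1, 0)` in which the steps along the
line `u = 1` are removed, except for the last one. -/
def reduced (W : StepWeights K) (k j : ℕ) : K :=
  if j = 0 then (if k = 0 then W.w 1 0 else 0) else (W.shift 1 0).pathSum j 0 (k + 1)

/-- A path on the line `u = 1` either steps further down it or leaves it for good. The step onto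
`(1, 0)` belongs to `reduced`: it finishes the path when `j = 0` and is a dead end otherwise. -/
theorem pathSum_succ_one (W : StepWeights K) (j v : ℕ) :
    W.pathSum (j + 1) 1 (v + 1) =
      (if v = 0 then 0 else W.w 1 v * W.pathSum (j + 1) 1 v) + W.reduced v j := by
  rw [pathSum_succ, if_neg one_ne_zero, reduced]
  by_cases hj : j = 0
  · subst hj
    rw [pathSum_of_lt _ (by omega), pathSum_of_lt _ (by omega), if_pos rfl]
    split_ifs with h
    · subst h; simp [pathSum_zero]
    · simp
  · rw [if_neg hj, pathSum_succ (W.shift 1 0), pathSum_shift_one_zero, pathSum_shift_one_zero]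
    simp only [shift, zero_add, add_zero, if_true]
    split_ifs with h
    · subst h
      rw [W.pathSum_zero (j + 1) 1, if_neg (by omega)]; ring
    · ring

theorem pathSum_one_eq_sum (W : StepWeights K) (j v : ℕ) {N : ℕ} (hN : v < N) :
    W.pathSum (j + 1) 1 (v + 1) = ∑ k ∈ Finset.range N, W.slide v k * W.reduced k j := by
  induction v with
  | zero => rw [pathSum_succ_one]; simp [slide, hN]
  | succ v ih =>
    rw [pathSum_succ_one, if_neg (Nat.succ_ne_zero v), ih (by omega)]
    simp only [slide, add_mul, Finset.sum_add_distrib, ite_mul, one_mul, zero_mul,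
      Finset.sum_ite_eq', Finset.mem_range, hN, if_true, Finset.mul_sum, mul_assoc]
    ring

/-- Cutting the paths where they leave the line `u = 1`. -/
theorem pathSum_eq_sum_columnStep (W : StepWeights K) (i j : ℕ) {N : ℕ} (hN : i < N) :
    W.pathSum (j + 1) 0 (i + 1) =
      ∑ k ∈ Finset.range N, W.columnStep i k * W.reduced k j +
        if i = 0 ∧ j = 0 then W.d 0 0 else 0 := by
  rw [pathSum_succ, zero_add, pathSum_one_eq_sum W j i hN]
  simp only [columnStep, add_mul, Finset.sum_add_distrib, if_true, add_zero, mul_assoc,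
    ← Finset.mul_sum]
  -- For `i = 0` the diagonal step goes straight from `(0, 1)` to `(1, 0)`. It never meets the
  -- points `(1, k + 1)`, so `columnStep` omits it and it is the corner term.
  cases i with
  | zero => simp [pathSum_zero]
  | succ i =>
    rw [pathSum_one_eq_sum W j i (by omega : i < N)]
    simp [Finset.mul_sum, mul_assoc]

/-- Cutting at `v = 1` factors the matrix of `reduced` as `Q * Y` with `Y` upper triangular. Column
`0` fits this pattern because `rowStep` keeps the step `w` on its left edge. -/
theorem reduced_eq_sum (W : StepWeights K) (k j : ℕ) {N : ℕ} (hN : j < N) :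
    W.reduced k j = ∑ u ∈ Finset.range N,
      (W.shift 1 1).pathSum u 0 k * (W.shift 1 0).rowStep j u := by
  have hs : (W.shift 1 0).shift 0 1 = W.shift 1 1 := rfl
  rw [reduced]
  split_ifs with hj hk
  · subst hj hk
    rw [Finset.sum_eq_single_of_mem 0 (by simpa using hN)
      fun u _ hu => by rw [rowStep_of_lt _ (by omega), mul_zero]]
    rw [rowStep_self, pathSum_zero]
    simp [shift]
  · subst hj
    symm
    refine Finset.sum_eq_zero fun u _ => ?_
    rcases Nat.eq_zero_or_pos u with rfl | hu
    · obtain ⟨k, rfl⟩ := Nat.exists_eq_succ_of_ne_zero hk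
      rw [pathSum_zero_zero_succ, zero_mul]
    · rw [rowStep_of_lt _ hu, mul_zero]
  · rw [← hs, pathSum_eq_sum_shift_zero_one _ (Nat.pos_of_ne_zero hj) hN]

/-- The determinant of the path sums from `(0, i)` to `(j, 0)`, for `i, j < k`. -/
def pathDet (W : StepWeights K) (k : ℕ) : K :=
  (Matrix.of fun i j : Fin k => W.pathSum j 0 i).det

/-- No step leaves `(0, 0)`, so the first row of the path matrix is a unit vector. -/
theorem pathDet_succ (W : StepWeights K) (k : ℕ) :
    W.pathDet (k + 1) = (Matrix.of fun i j : Fin k => W.pathSum (j + 1) 0 (i + 1)).det := by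
  rw [pathDet, Matrix.det_succ_row_zero, Fin.sum_univ_succ]
  have h0 : ∀ j : Fin k, W.pathSum (j + 1) 0 0 = 0 := fun j => by
    rw [pathSum_zero, if_neg (by omega)]
  simp only [Matrix.of_apply, Fin.val_zero, Fin.val_succ, h0, pathSum_zero]
  simp only [pow_zero, if_true, mul_one, one_mul, mul_zero, zero_mul, Finset.sum_const_zero,
    add_zero]
  rfl

theorem pathDet_zero (W : StepWeights K) : W.pathDet 0 = 1 := Matrix.det_isEmpty

theorem pathDet_one (W : StepWeights K) : W.pathDet 1 = 1 := by
  rw [pathDet_succ, Matrix.det_isEmpty]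

theorem pathDet_two (W : StepWeights K) : W.pathDet 2 = W.h 0 1 * W.w 1 0 + W.d 0 0 := by
  rw [pathDet_succ, Matrix.det_unique]
  simp only [Fin.default_eq_zero, Matrix.of_apply, Fin.val_zero, zero_add]
  rw [pathSum_one W one_pos, rowStep, if_neg (by omega), zero_add, rowStep_self]
  simp

end StepWeights

/-! ### Condensation of path determinants -/

theorem det_add_corner {R : Type*} [CommRing R] {k : ℕ} (M : Matrix (Fin (k + 1)) (Fin (k + 1)) R)
    (b : R) :
    (Matrix.of fun i j => M i j + if i = 0 ∧ j = 0 then b else 0).det =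
      M.det + b * (M.submatrix Fin.succ Fin.succ).det := by
  have hs : ∀ j : Fin (k + 1),
      (Matrix.of fun i j => M i j + if i = 0 ∧ j = 0 then b else 0).submatrix Fin.succ j.succAbove =
        M.submatrix Fin.succ j.succAbove := by
    intro j; ext i l; simp
  rw [Matrix.det_succ_row_zero, Matrix.det_succ_row_zero M, Fin.sum_univ_succ, Fin.sum_univ_succ]
  simp only [hs]
  have z1 : (Fin.succAbove (0 : Fin (k + 1))) = Fin.succ := by ext i; simp
  simp [z1]
  ring

namespace StepWeights

variable {K : Type*} [Field K]

/-- All path determinants here are, up to triangular factors and the corner weight `d 0 0`, minors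
of `X`, `Q * Y` and `X * (Q * Y)`. The diagonals of `X` and `Y` supply the weights `h` and `w`. -/
theorem pathDet_add_three_mul (W : StepWeights K) (m : ℕ) (hw : ∀ i ≤ m, W.w (i + 1) 0 ≠ 0) :
    W.pathDet (m + 3) * (W.shift 1 1).pathDet (m + 1) =
      W.h 0 (m + 2) * W.w (m + 2) 0 * (W.shift 1 1).pathDet (m + 2) * W.pathDet (m + 2) +
        W.d 0 0 * (W.shift 1 0).pathDet (m + 2) * (W.shift 0 1).pathDet (m + 2) := by
  set X : Matrix (Fin (m + 2)) (Fin (m + 2)) K := Matrix.of fun i k => W.columnStep i k with hXdef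
  set Q : Matrix (Fin (m + 2)) (Fin (m + 2)) K :=
    Matrix.of fun k u => (W.shift 1 1).pathSum u 0 k with hQ
  set Y : Matrix (Fin (m + 2)) (Fin (m + 2)) K :=
    Matrix.of fun u j => (W.shift 1 0).rowStep j u with hYdef
  set Z : Matrix (Fin (m + 1)) (Fin (m + 1)) K :=
    Matrix.of fun u j => W.rowStep (j + 1) (u + 1) with hZdef
  have hX : ∀ i j, i < j → X i j = 0 := fun i j hij => W.columnStep_of_lt hij
  have hY : ∀ i j, j < i → Y i j = 0 := fun i j hij => rowStep_of_lt _ hij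
  have hZ : ∀ i j, j < i → Z i j = 0 := fun i j hij =>
    rowStep_of_lt _ (Nat.succ_lt_succ hij)
  have hR : ∀ k j : Fin (m + 2), (Q * Y) k j = W.reduced k j := fun k j => by
    rw [W.reduced_eq_sum k j j.2, Matrix.mul_apply, Finset.sum_range]; rfl
  have hP : ∀ i j : Fin (m + 2), W.pathSum (j + 1) 0 (i + 1) =
      (X * (Q * Y)) i j + if i = 0 ∧ j = 0 then W.d 0 0 else 0 := fun i j => by
    rw [W.pathSum_eq_sum_columnStep i j i.2, Matrix.mul_apply, Finset.sum_range]
    simp only [hR, Fin.ext_iff, Fin.val_zero]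
    rfl
  have key := desnanot_jacobi_mul X (Q * Y) hX
  have dXc : (X.submatrix Fin.castSucc Fin.castSucc).det = ∏ i : Fin (m + 1), W.h 0 (i + 1) := by
    rw [det_of_isLower (X.submatrix Fin.castSucc Fin.castSucc)
      fun i j hij => hX i.castSucc j.castSucc (by simpa using hij)]
    exact Finset.prod_congr rfl fun i _ => W.columnStep_self i
  have dX : X.det = (∏ i : Fin (m + 1), W.h 0 (i + 1)) * W.h 0 (m + 2) := by
    rw [det_of_isLower X hX, Fin.prod_univ_castSucc]
    congr 1
    · exact Finset.prod_congr rfl fun i _ => W.columnStep_self i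
    · exact W.columnStep_self (m + 1)
  have dYc : (Y.submatrix Fin.castSucc Fin.castSucc).det = ∏ i : Fin (m + 1), W.w (i + 1) 0 := by
    rw [det_of_isUpper (Y.submatrix Fin.castSucc Fin.castSucc)
      fun i j hij => hY i.castSucc j.castSucc (by simpa using hij)]
    exact Finset.prod_congr rfl fun i _ => rowStep_self _ i
  have dY : Y.det = (∏ i : Fin (m + 1), W.w (i + 1) 0) * W.w (m + 2) 0 := by
    rw [det_of_isUpper Y hY, Fin.prod_univ_castSucc]
    congr 1
    · exact Finset.prod_congr rfl fun i _ => rowStep_self _ i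
    · exact rowStep_self _ (m + 1)
  have dZ : Z.det = ∏ i : Fin (m + 1), W.w (i + 1) 0 := by
    rw [det_of_isUpper Z hZ]
    exact Finset.prod_congr rfl fun i _ => rowStep_self _ _
  have dR : (Q * Y).det = (W.shift 1 1).pathDet (m + 2) * Y.det := Matrix.det_mul _ _
  have dRc : ((Q * Y).submatrix Fin.castSucc Fin.castSucc).det =
      (W.shift 1 1).pathDet (m + 1) * (Y.submatrix Fin.castSucc Fin.castSucc).det := by
    rw [submatrix_mul_castSucc_of_isUpper Q Y hY, Matrix.det_mul]
    rfl
  have dfull : W.pathDet (m + 3) = X.det * (Q * Y).det +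
      W.d 0 0 * ((X * (Q * Y)).submatrix Fin.succ Fin.succ).det := by
    rw [pathDet_succ, ← Matrix.det_mul, ← det_add_corner]
    simp only [hP]
  have dBL : W.pathDet (m + 2) = (X.submatrix Fin.castSucc Fin.castSucc).det *
        ((Q * Y).submatrix Fin.castSucc Fin.castSucc).det +
      W.d 0 0 * ((X * (Q * Y)).submatrix (fun i : Fin m => i.castSucc.succ)
        (fun i : Fin m => i.castSucc.succ)).det := by
    rw [pathDet_succ, ← Matrix.det_mul, ← submatrix_castSucc_mul_of_isLower X (Q * Y) hX]
    have := det_add_corner ((X * (Q * Y)).submatrix Fin.castSucc Fin.castSucc) (W.d 0 0)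
    rw [Matrix.submatrix_submatrix] at this
    refine Eq.trans ?_ this
    congr 1
    ext i j
    have h := hP i.castSucc j.castSucc
    simp only [Fin.val_castSucc, Fin.castSucc_eq_zero_iff] at h
    exact h
  have dBR : (W.shift 1 0).pathDet (m + 2) = ((Q * Y).submatrix Fin.castSucc Fin.succ).det := by
    rw [pathDet_succ]
    congr 1
    ext k j
    simp [hR, reduced]
  -- Dropping row `0` removes the corner term. Cutting at `v = 1` in the unshifted network then
  -- factors the rest through the triangular `Z`; the term `k = 0` vanishes because `(0, 0)` cannot
  -- be reached from above.
  have dTL : ((X * (Q * Y)).submatrix Fin.succ Fin.castSucc).det =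
      (W.shift 0 1).pathDet (m + 2) * Z.det := by
    rw [pathDet_succ, ← Matrix.det_mul]
    congr 1
    ext i j
    have h := hP i.succ j.castSucc
    rw [if_neg (by simp), add_zero] at h
    rw [Matrix.submatrix_apply, ← h]
    simp only [Fin.val_castSucc, Fin.val_succ]
    rw [W.pathSum_eq_sum_shift_zero_one (Nat.succ_pos _) (by omega : (j : ℕ) + 1 < m + 2),
      Finset.sum_range_succ', pathSum_zero_zero_succ, zero_mul, add_zero, Matrix.mul_apply,
      Finset.sum_range]
    rfl
  have hl : X (Fin.last _) (Fin.last _) = W.h 0 (m + 2) := W.columnStep_self (m + 1)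
  have hω : (∏ i : Fin (m + 1), W.w (i + 1) 0) ≠ 0 :=
    Finset.prod_ne_zero_iff.2 fun i _ => hw i (by omega)
  rw [hl, dR, dRc, dTL, dYc, dZ, dY, ← dBR] at key
  rw [dXc, dRc, dYc] at dBL
  rw [dX, dR, dY] at dfull
  apply mul_right_cancel₀ hω
  rw [dfull, dBL]
  -- The terms free of `d 0 0` cancel identically.
  linear_combination W.d 0 0 * key

/-- The condensation identity for the path determinants. -/
theorem pathDet_add_two_mul (W : StepWeights K) (k : ℕ) (hw : ∀ i < k, W.w (i + 1) 0 ≠ 0) :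
    W.pathDet (k + 2) * (W.shift 1 1).pathDet k =
      W.h 0 (k + 1) * W.w (k + 1) 0 * (W.shift 1 1).pathDet (k + 1) * W.pathDet (k + 1) +
        W.d 0 0 * (W.shift 1 0).pathDet (k + 1) * (W.shift 0 1).pathDet (k + 1) := by
  cases k with
  | zero => simp [pathDet_zero, pathDet_one, pathDet_two]
  | succ m => exact W.pathDet_add_three_mul m fun i hi => hw i (by omega)

end StepWeights

/-! ### Sign-reversing exchange of tails -/

section Exchange

variable {V : Type*}

/-- `τ` transposes two indices of lists that contain `p`. -/
def IsSwapAt {m : ℕ} (p : V) (L : Fin m → List V) (τ : Equiv.Perm (Fin m)) : Prop :=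
  ∃ i j, i ≠ j ∧ p ∈ L i ∧ p ∈ L j ∧ τ = Equiv.swap i j

theorem IsSwapAt.cases {m : ℕ} {p : V} {L : Fin m → List V} {τ : Equiv.Perm (Fin m)}
    (h : IsSwapAt p L τ) (k : Fin m) : τ k = k ∨ (p ∈ L k ∧ p ∈ L (τ k)) := by
  obtain ⟨i, j, -, hi, hj, rfl⟩ := h
  by_cases h1 : k = i
  · subst h1; rw [Equiv.swap_apply_left]; exact Or.inr ⟨hi, hj⟩
  by_cases h2 : k = j
  · subst h2; rw [Equiv.swap_apply_right]; exact Or.inr ⟨hj, hi⟩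
  exact Or.inl (Equiv.swap_apply_of_ne_of_ne h1 h2)

theorem IsSwapAt.apply_apply {m : ℕ} {p : V} {L : Fin m → List V} {τ : Equiv.Perm (Fin m)}
    (h : IsSwapAt p L τ) (k : Fin m) : τ (τ k) = k := by
  obtain ⟨i, j, -, hi, hj, rfl⟩ := h
  exact Equiv.swap_apply_self i j k

variable [DecidableEq V]

/-- The list `l` up to its first occurrence of `p`, followed by `l'` from its first occurrence of
`p` on. -/
def cut (p : V) (l l' : List V) : List V :=
  l.takeWhile (fun q => decide (q ≠ p)) ++ l'.dropWhile (fun q => decide (q ≠ p))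

theorem takeWhile_ne_append_cons {p : V} {a : List V} (ha : p ∉ a) (b : List V) :
    (a ++ p :: b).takeWhile (fun q => decide (q ≠ p)) = a := by
  rw [List.takeWhile_append_of_pos fun q hq => by simpa using fun h : q = p => ha (h ▸ hq)]
  simp

theorem dropWhile_ne_append_cons {p : V} {a : List V} (ha : p ∉ a) (b : List V) :
    (a ++ p :: b).dropWhile (fun q => decide (q ≠ p)) = p :: b := by
  rw [List.dropWhile_append_of_pos fun q hq => by simpa using fun h : q = p => ha (h ▸ hq)]
  simp

theorem cut_append_cons {p : V} {a a' : List V} (ha : p ∉ a) (ha' : p ∉ a') (b b' : List V) :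
    cut p (a ++ p :: b) (a' ++ p :: b') = a ++ p :: b' := by
  rw [cut, takeWhile_ne_append_cons ha, dropWhile_ne_append_cons ha']

theorem cut_self (p : V) (l : List V) : cut p l l = l := List.takeWhile_append_dropWhile

theorem cut_cut {p : V} {l l' : List V} (h : p ∈ l) (h' : p ∈ l') :
    cut p (cut p l l') (cut p l' l) = l := by
  obtain ⟨a, b, rfl, ha⟩ := List.eq_append_cons_of_mem h
  obtain ⟨a', b', rfl, ha'⟩ := List.eq_append_cons_of_mem h'
  rw [cut_append_cons ha ha', cut_append_cons ha' ha, cut_append_cons ha ha']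

theorem mem_cut_of_mem {p : V} (l : List V) {l' : List V} (h' : p ∈ l') : p ∈ cut p l l' := by
  obtain ⟨a', b', rfl, ha'⟩ := List.eq_append_cons_of_mem h'
  rw [cut, dropWhile_ne_append_cons ha']
  simp

/-- The number of occurrences of a vertex in a family of lists. -/
def occurrences {m : ℕ} (L : Fin m → List V) (v : V) : ℕ := ∑ k, (L k).count v

theorem two_le_occurrences_iff {m : ℕ} {L : Fin m → List V} (hL : ∀ k, (L k).Nodup) (v : V) :
    2 ≤ occurrences L v ↔ ∃ i j, i ≠ j ∧ v ∈ L i ∧ v ∈ L j := by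
  have h : occurrences L v = (Finset.univ.filter fun k => v ∈ L k).card := by
    rw [Finset.card_filter]
    exact Finset.sum_congr rfl fun k _ => (hL k).count
  rw [h, ← Nat.succ_le_iff.symm.trans Iff.rfl, Finset.one_lt_card]
  simp only [Finset.mem_filter, Finset.mem_univ, true_and]
  constructor
  · rintro ⟨i, hi, j, hj, hij⟩
    exact ⟨i, j, hij, hi, hj⟩
  · rintro ⟨i, j, hij, hi, hj⟩
    exact ⟨i, hi, j, hj, hij⟩

/-- The family obtained by exchanging tails at `p` along a permutation of the indices. -/
def exchange {m : ℕ} (p : V) (τ : Equiv.Perm (Fin m)) (L : Fin m → List V) : Fin m → List V :=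
  fun k => cut p (L k) (L (τ k))

/-- The initial segments stay in place and the tails are merely permuted. -/
theorem occurrences_exchange {m : ℕ} (p : V) (τ : Equiv.Perm (Fin m)) (L : Fin m → List V) :
    occurrences (exchange p τ L) = occurrences L := by
  funext v
  simp only [occurrences, exchange, cut, List.count_append, Finset.sum_add_distrib]
  rw [Equiv.sum_comp τ fun k => ((L k).dropWhile fun q => decide (q ≠ p)).count v,
    ← Finset.sum_add_distrib]
  exact Finset.sum_congr rfl fun k _ => by
    rw [← List.count_append, List.takeWhile_append_dropWhile]

theorem IsSwapAt.mem_exchange_iff {m : ℕ} {p : V} {L : Fin m → List V} {τ : Equiv.Perm (Fin m)}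
    (h : IsSwapAt p L τ) (k : Fin m) : p ∈ exchange p τ L k ↔ p ∈ L k := by
  rw [exchange]
  rcases h.cases k with hk | ⟨hk, hk'⟩
  · rw [hk, cut_self]
  · exact iff_of_true (mem_cut_of_mem _ hk') hk

theorem IsSwapAt.exchange_exchange {m : ℕ} {p : V} {L : Fin m → List V} {τ : Equiv.Perm (Fin m)}
    (h : IsSwapAt p L τ) : exchange p τ (exchange p τ L) = L := by
  funext k
  simp only [exchange, h.apply_apply]
  rcases h.cases k with hk | ⟨hk, hk'⟩
  · simp only [hk, cut_self]
  · exact cut_cut hk hk'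

/-- A vertex occurring at least twice, if there is one; it depends only on the numbers of
occurrences. -/
def pivot [Nonempty V] (c : V → ℕ) : V := Classical.epsilon fun v => 2 ≤ c v

/-- A transposition of two elements of a set of indices, if there is one. -/
def swapOf {m : ℕ} (I : Set (Fin m)) : Equiv.Perm (Fin m) :=
  Classical.epsilon fun τ => ∃ i j, i ≠ j ∧ i ∈ I ∧ j ∈ I ∧ τ = Equiv.swap i j

/-- The transposition used in the exchange of tails of a family. -/
def familySwap [Nonempty V] {m : ℕ} (L : Fin m → List V) : Equiv.Perm (Fin m) :=
  swapOf {k | pivot (occurrences L) ∈ L k}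

/-- The exchange of tails of two members of a family at a common vertex. -/
def familyExchange [Nonempty V] {m : ℕ} (L : Fin m → List V) : Fin m → List V :=
  exchange (pivot (occurrences L)) (familySwap L) L

theorem isSwapAt_familySwap [Nonempty V] {m : ℕ} {L : Fin m → List V} (hL : ∀ k, (L k).Nodup)
    (h : ∃ v i j, i ≠ j ∧ v ∈ L i ∧ v ∈ L j) :
    IsSwapAt (pivot (occurrences L)) L (familySwap L) := by
  have h1 : 2 ≤ occurrences L (pivot (occurrences L)) := by
    obtain ⟨v, hv⟩ := h
    exact Classical.epsilon_spec (p := fun v => 2 ≤ occurrences L v) ⟨v, (two_le_occurrences_iff hL v).2 hv⟩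
  obtain ⟨i, j, hij, hi, hj⟩ := (two_le_occurrences_iff hL _).1 h1
  exact Classical.epsilon_spec (p := fun τ : Equiv.Perm (Fin m) => ∃ i j, i ≠ j ∧
    i ∈ {k | pivot (occurrences L) ∈ L k} ∧ j ∈ {k | pivot (occurrences L) ∈ L k} ∧
      τ = Equiv.swap i j) ⟨_, i, j, hij, hi, hj, rfl⟩

theorem occurrences_familyExchange [Nonempty V] {m : ℕ} (L : Fin m → List V) :
    occurrences (familyExchange L) = occurrences L := occurrences_exchange _ _ _

/-- The choices of vertex and transposition depend only on the occurrence counts and on which lists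
contain the chosen vertex. Exchange preserves both, so the second exchange undoes the first. -/
theorem familySwap_familyExchange [Nonempty V] {m : ℕ} {L : Fin m → List V}
    (h : IsSwapAt (pivot (occurrences L)) L (familySwap L)) :
    familySwap (familyExchange L) = familySwap L := by
  rw [familySwap, occurrences_familyExchange]
  exact congrArg swapOf (Set.ext fun k => h.mem_exchange_iff k)

theorem familyExchange_familyExchange [Nonempty V] {m : ℕ} {L : Fin m → List V}
    (h : IsSwapAt (pivot (occurrences L)) L (familySwap L)) :
    familyExchange (familyExchange L) = L := by
  rw [familyExchange, occurrences_familyExchange, familySwap_familyExchange h]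
  exact h.exchange_exchange

end Exchange

/-! ### The Lindström–Gessel–Viennot lemma -/

variable {K : Type*} [Field K] {n : ℕ}

theorem listWeight_append_cons (A : Matrix (Fin n) (Fin n) K) (lam mu : ℤ → K)
    (a : List (ℤ × ℤ)) (p : ℤ × ℤ) (b : List (ℤ × ℤ)) :
    listWeight A lam mu (a ++ p :: b) =
      listWeight A lam mu (a ++ [p]) * listWeight A lam mu (p :: b) := by
  induction a with
  | nil => simp [listWeight]
  | cons q a ih =>
    cases a with
    | nil => simp [listWeight]
    | cons q' a => simpa [listWeight, mul_assoc] using congrArg (edgeWeight A lam mu q q' * ·) ih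

theorem IsPath.cut {u v u' v' p : ℤ × ℤ} {l l' : List (ℤ × ℤ)} (h : IsPath n u v l)
    (h' : IsPath n u' v' l') (hp : p ∈ l) (hp' : p ∈ l') : IsPath n u v' (cut p l l') := by
  obtain ⟨a, b, rfl, ha⟩ := List.eq_append_cons_of_mem hp
  obtain ⟨a', b', rfl, ha'⟩ := List.eq_append_cons_of_mem hp'
  rw [cut_append_cons ha ha']
  obtain ⟨h1, h2, h3, h4⟩ := h
  obtain ⟨h1', h2', h3', h4'⟩ := h'
  refine ⟨?_, ?_, ?_, ?_⟩
  · intro q hq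
    rcases List.mem_append.1 hq with hq | hq
    · exact h1 q (List.mem_append_left _ hq)
    · exact h1' q (List.mem_append_right _ hq)
  · rw [List.isChain_append] at h2 h2' ⊢
    exact ⟨h2.1, h2'.2.1, by simpa using h2.2.2⟩
  · cases a <;> simpa using h3
  · rw [List.getLast?_append_cons] at h4' ⊢
    exact h4'

/-- The weight of a list through `p` splits at `p` into a head factor `f` and a tail factor `g`; a
list avoiding `p` has `g = 1`. Exchange only permutes the factors `g`. -/
theorem prod_listWeight_exchange (A : Matrix (Fin n) (Fin n) K) (lam mu : ℤ → K) {m : ℕ}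
    {p : ℤ × ℤ} {L : Fin m → List (ℤ × ℤ)} {τ : Equiv.Perm (Fin m)} (h : IsSwapAt p L τ) :
    ∏ k, listWeight A lam mu (exchange p τ L k) = ∏ k, listWeight A lam mu (L k) := by
  set f : Fin m → K := fun k => if p ∈ L k then
    listWeight A lam mu ((L k).takeWhile (fun q => decide (q ≠ p)) ++ [p])
    else listWeight A lam mu (L k) with hf
  set g : Fin m → K := fun k => if p ∈ L k then
    listWeight A lam mu ((L k).dropWhile (fun q => decide (q ≠ p))) else 1 with hg
  have h0 : ∀ k, f k * g k = listWeight A lam mu (L k) := fun k => by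
    simp only [hf, hg]
    split_ifs with hk
    · obtain ⟨a, b, hab, ha⟩ := List.eq_append_cons_of_mem hk
      rw [hab, takeWhile_ne_append_cons ha, dropWhile_ne_append_cons ha, ← listWeight_append_cons]
    · rw [mul_one]
  have h1 : ∀ k, f k * g (τ k) = listWeight A lam mu (exchange p τ L k) := fun k => by
    rcases h.cases k with hk | ⟨hk, hk'⟩
    · rw [hk, h0, exchange, hk, cut_self]
    · simp only [hf, hg, if_pos hk, if_pos hk', exchange]
      obtain ⟨a, b, hab, ha⟩ := List.eq_append_cons_of_mem hk
      obtain ⟨a', b', hab', ha'⟩ := List.eq_append_cons_of_mem hk'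
      rw [hab, hab', takeWhile_ne_append_cons ha, dropWhile_ne_append_cons ha',
        cut_append_cons ha ha', ← listWeight_append_cons]
  simp only [← h0, ← h1, Finset.prod_mul_distrib]
  rw [Equiv.prod_comp τ g]

/-- The finite set of the paths from `u` to `v`. -/
def pathFinset (n : ℕ) (u v : ℤ × ℤ) : Finset (List (ℤ × ℤ)) :=
  (Finset.univ : Finset (Path n u v)).map ⟨fun p : Path n u v => p.1, fun _ _ h => Subtype.ext h⟩

theorem mem_pathFinset {u v : ℤ × ℤ} {l : List (ℤ × ℤ)} :
    l ∈ pathFinset n u v ↔ IsPath n u v l := by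
  exact Finset.mem_map.trans ⟨fun ⟨p, _, hp⟩ => hp ▸ p.2, fun h => ⟨⟨l, h⟩, Finset.mem_univ _, rfl⟩⟩

theorem sum_pathFinset (u v : ℤ × ℤ) (f : List (ℤ × ℤ) → K) :
    ∑ l ∈ pathFinset n u v, f l = ∑ p : Path n u v, f p.1 :=
  Finset.sum_map _ _ _

/-- The families of paths from the vertices `s i` to the vertices `t (σ i)`, for all permutations
`σ`. -/
def pathFamilies (n : ℕ) {m : ℕ} (s t : Fin m → ℤ × ℤ) :
    Finset (Σ _ : Equiv.Perm (Fin m), Fin m → List (ℤ × ℤ)) :=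
  Finset.univ.sigma fun σ => Fintype.piFinset fun i => pathFinset n (s i) (t (σ i))

theorem mem_pathFamilies {m : ℕ} {s t : Fin m → ℤ × ℤ}
    {x : Σ _ : Equiv.Perm (Fin m), Fin m → List (ℤ × ℤ)} :
    x ∈ pathFamilies n s t ↔ ∀ i, IsPath n (s i) (t (x.1 i)) (x.2 i) := by
  simp [pathFamilies, mem_pathFinset]

open Classical in
/-- The **Lindström–Gessel–Viennot lemma**. -/
theorem det_sum_paths_eq (A : Matrix (Fin n) (Fin n) K) (lam mu : ℤ → K) {m : ℕ}
    (s t : Fin m → ℤ × ℤ) :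
    (Matrix.of fun i j => ∑ p : Path n (s i) (t j), listWeight A lam mu p.1).det =
      ∑ x ∈ (pathFamilies n s t).filter (fun x => ¬ ∃ v i j, i ≠ j ∧ v ∈ x.2 i ∧ v ∈ x.2 j),
        ((Equiv.Perm.sign x.1 : ℤ) : K) * ∏ i, listWeight A lam mu (x.2 i) := by
  have hexp : (Matrix.of fun i j => ∑ p : Path n (s i) (t j), listWeight A lam mu p.1).det =
      ∑ x ∈ pathFamilies n s t,
        ((Equiv.Perm.sign x.1 : ℤ) : K) * ∏ i, listWeight A lam mu (x.2 i) := by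
    -- After transposing, `σ` sends sources to targets.
    rw [← Matrix.det_transpose, Matrix.det_apply', pathFamilies, Finset.sum_sigma]
    refine Finset.sum_congr rfl fun σ _ => ?_
    dsimp only
    rw [← Finset.mul_sum, ← Finset.prod_univ_sum]
    exact congrArg _ (Finset.prod_congr rfl fun i _ => (sum_pathFinset _ _ _).symm)
  rw [hexp, ← Finset.sum_filter_not_add_sum_filter _
    (fun x => ∃ v i j, i ≠ j ∧ v ∈ x.2 i ∧ v ∈ x.2 j), add_eq_left]
  have hswap : ∀ x ∈ (pathFamilies n s t).filter
      (fun x => ∃ v i j, i ≠ j ∧ v ∈ x.2 i ∧ v ∈ x.2 j),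
      IsSwapAt (pivot (occurrences x.2)) x.2 (familySwap x.2) := fun x hx => by
    rw [Finset.mem_filter, mem_pathFamilies] at hx
    exact isSwapAt_familySwap (fun k => (hx.1 k).nodup) hx.2
  refine Finset.sum_involution
    (fun x _ => ⟨x.1 * familySwap x.2, familyExchange x.2⟩) ?_ ?_ ?_ ?_
  · intro x hx
    have h := hswap x hx
    rw [familyExchange, prod_listWeight_exchange A lam mu h]
    obtain ⟨i, j, hij, -, -, hτ⟩ := h
    rw [hτ, Equiv.Perm.sign_mul, Equiv.Perm.sign_swap hij]
    simp
  · intro x hx _ hfix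
    obtain ⟨i, j, hij, -, -, hτ⟩ := hswap x hx
    have h1 : x.1 * familySwap x.2 = x.1 := congrArg Sigma.fst hfix
    rw [mul_eq_left, hτ] at h1
    exact hij (Equiv.swap_eq_one_iff.1 h1)
  · intro x hx
    have h := hswap x hx
    rw [Finset.mem_filter, mem_pathFamilies] at hx ⊢
    have hpath : ∀ i, IsPath n (s i) (t ((x.1 * familySwap x.2) i)) (familyExchange x.2 i) := by
      intro i
      rw [familyExchange, exchange, Equiv.Perm.mul_apply]
      rcases h.cases i with hi | ⟨hi, hi'⟩
      · rw [hi, cut_self]; exact hx.1 i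
      · exact (hx.1 i).cut (hx.1 _) hi hi'
    refine ⟨hpath, ?_⟩
    obtain ⟨v, hv⟩ := hx.2
    refine ⟨v, ?_⟩
    rw [← two_le_occurrences_iff fun k => (hx.1 k).nodup] at hv
    rw [← two_le_occurrences_iff fun k => (hpath k).nodup, occurrences_familyExchange]
    exact hv
  · intro x hx
    have h := hswap x hx
    refine Sigma.ext ?_ (heq_of_eq ?_)
    · simp only [familySwap_familyExchange h]
      ext1 k
      simp [h.apply_apply]
    · exact familyExchange_familyExchange h

/-! ### Paths on the diamond -/

theorem inDiamond_iff {p : ℤ × ℤ} : InDiamond n p ↔ (p.1 + p.2) % 2 = 0 ∧ p.1 ≤ p.2 ∧ -p.1 ≤ p.2 ∧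
    p.1 + p.2 ≤ 2 * n - 2 ∧ p.2 - p.1 ≤ 2 * n - 2 := by
  unfold InDiamond
  rcases abs_cases p.1 with h1 | h1 <;> rcases abs_cases (p.2 - n + 1) with h2 | h2 <;> omega

theorem IsPath.cases {u v : ℤ × ℤ} {l : List (ℤ × ℤ)} (h : IsPath n u v l) :
    InDiamond n u ∧
      ((l = [u] ∧ u = v) ∨ ∃ q l', l = u :: l' ∧ Edge n u q ∧ IsPath n q v l') := by
  obtain ⟨h1, h2, h3, h4⟩ := h
  match l with
  | [] => simp at h3
  | [a] =>
    simp at h3 h4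
    subst h3 h4
    exact ⟨h1 _ (by simp), Or.inl ⟨rfl, rfl⟩⟩
  | a :: b :: l =>
    simp at h3
    subst h3
    refine ⟨h1 _ (by simp), Or.inr ⟨b, b :: l, rfl, ?_, ?_, ?_, rfl, ?_⟩⟩
    · exact (List.isChain_cons_cons.1 h2).1
    · exact fun p hp => h1 p (List.mem_cons_of_mem _ hp)
    · exact (List.isChain_cons_cons.1 h2).2
    · simpa using h4

theorem IsPath.cons {u q v : ℤ × ℤ} {l : List (ℤ × ℤ)} (he : Edge n u q) (h : IsPath n q v l) :
    IsPath n u v (u :: l) := by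
  obtain ⟨h1, h2, h3, h4⟩ := h
  match l with
  | [] => simp at h3
  | b :: l =>
    simp at h3
    subst h3
    refine ⟨?_, List.isChain_cons_cons.2 ⟨he, h2⟩, rfl, by simpa using h4⟩
    intro p hp
    rcases List.mem_cons.1 hp with rfl | hp
    · exact he.1
    · exact h1 p hp

theorem IsPath.head_mem {u v : ℤ × ℤ} {l : List (ℤ × ℤ)} (h : IsPath n u v l) : u ∈ l :=
  List.mem_of_head? h.2.2.1

theorem IsPath.last_mem {u v : ℤ × ℤ} {l : List (ℤ × ℤ)} (h : IsPath n u v l) : v ∈ l :=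
  List.mem_of_getLast? h.2.2.2

theorem IsPath.fst_le {u v : ℤ × ℤ} {l : List (ℤ × ℤ)} (h : IsPath n u v l) : u.1 ≤ v.1 := by
  induction l generalizing u with
  | nil => simpa using h.2.2.1
  | cons a l ih =>
    rcases h.cases.2 with ⟨-, rfl⟩ | ⟨q, l', hl, he, hp⟩
    · exact le_rfl
    · obtain ⟨rfl, rfl⟩ := List.cons_eq_cons.1 hl
      have := ih hp
      obtain ⟨-, -, ⟨rfl, -⟩ | rfl | ⟨rfl, -⟩⟩ := he <;> simp at this <;> omega

/-- Two disjoint paths ending on the lower right border keep their vertical order. The vertices `p`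
and `p'` are either at horizontal distance at most `2`, with `p` lower than `p'`, or `p` is on the
lower left border and `p'` further to the left. -/
theorem le_of_disjoint_paths {p p' : ℤ × ℤ} {j j' : ℤ} {l l' : List (ℤ × ℤ)}
    (h : IsPath n p (j, j) l) (h' : IsPath n p' (j', j') l') (hd : l.Disjoint l')
    (hpp' : (-1 ≤ p.1 - p'.1 ∧ p.1 - p'.1 ≤ 2 ∧ p.2 < p'.2) ∨ (p.1 + p.2 = 0 ∧ p'.1 < p.1)) :
    j ≤ j' := by
  -- The path whose head is further left is advanced, `p` in case of a tie, so the heads stay within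
  -- the horizontal window. By the parity of `x + y`, the lower head can lose its place only by
  -- landing on the other one, which disjointness forbids.
  induction hN : l.length + l'.length using Nat.strong_induction_on generalizing p p' l l' with
  | _ N ih =>
    obtain ⟨hp, hc⟩ := h.cases
    obtain ⟨hp', hc'⟩ := h'.cases
    rw [inDiamond_iff] at hp hp'
    by_cases hx : p.1 ≤ p'.1
    · rcases hc with ⟨-, rfl⟩ | ⟨q, l₁, rfl, he, hq⟩
      · have := h'.fst_le
        simp only at this hx
        omega
      · have hne : q ≠ p' := fun h0 => hd (List.mem_cons_of_mem _ hq.head_mem) (h0 ▸ h'.head_mem)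
        refine ih _ ?_ hq h' (List.disjoint_of_disjoint_cons_left hd) ?_ rfl
        · simp at hN; omega
        · obtain ⟨-, hq', hq''⟩ := he
          rw [inDiamond_iff] at hq'
          rw [Ne, Prod.ext_iff] at hne
          obtain ⟨rfl, -⟩ | rfl | ⟨rfl, -⟩ := hq'' <;> simp only at hne hq' ⊢ <;> omega
    · rcases hc' with ⟨-, rfl⟩ | ⟨q, l₁, rfl, he, hq⟩
      · simp only at hp' hx hpp'
        omega
      · have hne : p ≠ q := fun h0 => hd h.head_mem (List.mem_cons_of_mem _ (h0 ▸ hq.head_mem))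
        refine ih _ ?_ h hq (List.disjoint_of_disjoint_cons_right hd) ?_ rfl
        · simp at hN; omega
        · obtain ⟨-, hq', hq''⟩ := he
          rw [inDiamond_iff] at hq'
          rw [Ne, Prod.ext_iff] at hne
          obtain ⟨rfl, -⟩ | rfl | ⟨rfl, -⟩ := hq'' <;> simp only at hne hq' ⊢ <;> omega

/-- A family of non-intersecting paths from the lower left to the lower right border connects the
`i`-th entry to the `i`-th exit. -/
theorem eq_id_of_disjoint_paths {g : Fin n → Fin n} {L : Fin n → List (ℤ × ℤ)}
    (hL : ∀ i : Fin n, IsPath n (-((i : ℕ) : ℤ), ((i : ℕ) : ℤ)) (((g i : ℕ) : ℤ), ((g i : ℕ) : ℤ)) (L i))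
    (hd : ∀ i i', i ≠ i' → List.Disjoint (L i) (L i')) : g = id := by
  have hg : StrictMono g := by
    intro i i' hii'
    refine lt_of_le_of_ne ?_ fun he => ?_
    · have := le_of_disjoint_paths (hL i) (hL i') (hd i i' hii'.ne)
        (Or.inr ⟨by simp, by simpa using hii'⟩)
      exact_mod_cast this
    · have h := (hL i').last_mem
      rw [← he] at h
      exact hd i i' hii'.ne (hL i).last_mem h
  exact hg.eq_id

open Classical in
-- Disjoint families connect entry `i` to exit `i`, so only the identity permutation survives in
-- Lindström–Gessel–Viennot.
theorem det_eq_partitionFunction (A : Matrix (Fin n) (Fin n) K) (lam mu : ℤ → K) :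
    (Matrix.of fun i j : Fin n => ∑ p : Path n (-((i : ℕ) : ℤ), ((i : ℕ) : ℤ))
      (((j : ℕ) : ℤ), ((j : ℕ) : ℤ)), listWeight A lam mu p.1).det =
      partitionFunction A lam mu := by
  rw [det_sum_paths_eq A lam mu (fun i : Fin n => (-((i : ℕ) : ℤ), ((i : ℕ) : ℤ)))
    (fun j : Fin n => (((j : ℕ) : ℤ), ((j : ℕ) : ℤ))), partitionFunction]
  symm
  have hend : ∀ f : NonIntersecting n, ∀ i, (f.1 i).1 = i := fun f i =>
    congrFun (eq_id_of_disjoint_paths (g := fun i => (f.1 i).1) (L := fun i => (f.1 i).2.1)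
      (fun i => (f.1 i).2.2) f.2) i
  refine Finset.sum_nbij (fun f => ⟨1, fun i => (f.1 i).2.1⟩) ?_ ?_ ?_ ?_
  · intro f _
    rw [Finset.mem_filter, mem_pathFamilies]
    refine ⟨fun i => ?_, ?_⟩
    · have h : ∀ k, (f.1 i).1 = k → IsPath n (-((i : ℕ) : ℤ), ((i : ℕ) : ℤ))
          (((k : ℕ) : ℤ), ((k : ℕ) : ℤ)) (f.1 i).2.1 := fun k hk => hk ▸ (f.1 i).2.2
      exact h i (hend f i)
    · rintro ⟨v, i, j, hij, hi, hj⟩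
      exact f.2 i j hij hi hj
  · intro f _ f' _ hff'
    have hL := eq_of_heq (Sigma.mk.inj hff').2
    refine Subtype.ext (funext fun i => ?_)
    have h1 : (f.1 i).1 = (f'.1 i).1 := (hend f i).trans (hend f' i).symm
    have h2 : (f.1 i).2.1 = (f'.1 i).2.1 := congrFun hL i
    generalize f.1 i = x at h1 h2
    generalize f'.1 i = y at h1 h2
    obtain ⟨x1, x2⟩ := x
    obtain ⟨y1, y2⟩ := y
    obtain rfl : x1 = y1 := h1
    exact congrArg _ (Subtype.ext h2)
  · rintro ⟨σ, L⟩ hx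
    rw [Finset.mem_coe, Finset.mem_filter, mem_pathFamilies] at hx
    obtain ⟨hL, hd⟩ := hx
    have hd' : ∀ i i', i ≠ i' → List.Disjoint (L i) (L i') := fun i i' hii' v hv hv' =>
      hd ⟨v, i, i', hii', hv, hv'⟩
    have hσ : σ = 1 := Equiv.ext fun i => congrFun (eq_id_of_disjoint_paths hL hd') i
    subst hσ
    exact ⟨⟨fun i => ⟨i, L i, hL i⟩, hd'⟩, Finset.mem_coe.2 (Finset.mem_univ _), rfl⟩
  · intro f _
    simp

/-! ### The path sums of the network -/

theorem listWeight_cons (A : Matrix (Fin n) (Fin n) K) (lam mu : ℤ → K) {u q v : ℤ × ℤ}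
    {l : List (ℤ × ℤ)} (h : IsPath n q v l) :
    listWeight A lam mu (u :: l) = edgeWeight A lam mu u q * listWeight A lam mu l := by
  obtain ⟨-, -, h3, -⟩ := h
  match l with
  | [] => simp at h3
  | b :: l =>
    simp at h3
    subst h3
    rfl

theorem sum_pathFinset_self (A : Matrix (Fin n) (Fin n) K) (lam mu : ℤ → K) {v : ℤ × ℤ}
    (hv : InDiamond n v) : ∑ l ∈ pathFinset n v v, listWeight A lam mu l = 1 := by
  have h : pathFinset n v v = {[v]} := by
    ext l
    rw [mem_pathFinset, Finset.mem_singleton]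
    constructor
    · intro h
      rcases h.cases.2 with ⟨h, -⟩ | ⟨q, l', -, he, hp⟩
      · exact h
      · have := hp.fst_le
        obtain ⟨-, -, ⟨rfl, -⟩ | rfl | ⟨rfl, -⟩⟩ := he <;> simp at this
    · rintro rfl
      exact ⟨by simpa using hv, by simp, rfl, rfl⟩
  rw [h, Finset.sum_singleton, listWeight]

open Classical in
theorem sum_pathFinset_of_ne (A : Matrix (Fin n) (Fin n) K) (lam mu : ℤ → K) {u v : ℤ × ℤ}
    (huv : u ≠ v) :
    ∑ l ∈ pathFinset n u v, listWeight A lam mu l =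
      (if Edge n u (u.1 + 1, u.2 + 1) then edgeWeight A lam mu u (u.1 + 1, u.2 + 1) *
        ∑ l ∈ pathFinset n (u.1 + 1, u.2 + 1) v, listWeight A lam mu l else 0) +
      (if Edge n u (u.1 + 2, u.2) then edgeWeight A lam mu u (u.1 + 2, u.2) *
        ∑ l ∈ pathFinset n (u.1 + 2, u.2) v, listWeight A lam mu l else 0) +
      (if Edge n u (u.1 + 1, u.2 - 1) then edgeWeight A lam mu u (u.1 + 1, u.2 - 1) *
        ∑ l ∈ pathFinset n (u.1 + 1, u.2 - 1) v, listWeight A lam mu l else 0) := by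
  set N : Finset (ℤ × ℤ) := {(u.1 + 1, u.2 + 1), (u.1 + 2, u.2), (u.1 + 1, u.2 - 1)} with hN
  trans ∑ q ∈ N, if Edge n u q then edgeWeight A lam mu u q *
        ∑ l ∈ pathFinset n q v, listWeight A lam mu l else 0
  · rw [← Finset.sum_filter]
    simp only [Finset.mul_sum]
    rw [Finset.sum_sigma']
    symm
    refine Finset.sum_nbij (fun x => u :: x.2) ?_ ?_ ?_ ?_
    · rintro ⟨q, l⟩ h
      simp only [Finset.mem_sigma, Finset.mem_filter, mem_pathFinset] at h ⊢
      exact h.2.cons h.1.2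
    · rintro ⟨q, l⟩ h ⟨q', l'⟩ h' he
      simp only [Finset.mem_coe, Finset.mem_sigma, Finset.mem_filter, mem_pathFinset] at h h'
      obtain rfl : l = l' := (List.cons_eq_cons.1 he).2
      obtain rfl : q = q' := Option.some_injective _ (h.2.2.2.1.symm.trans h'.2.2.2.1)
      rfl
    · intro l hl
      rw [Finset.mem_coe, mem_pathFinset] at hl
      rcases hl.cases.2 with ⟨-, h⟩ | ⟨q, l', rfl, he, hp⟩
      · exact absurd h huv
      · refine ⟨⟨q, l'⟩, ?_, rfl⟩
        simp only [Finset.mem_coe, Finset.mem_sigma, Finset.mem_filter, mem_pathFinset]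
        refine ⟨⟨?_, he⟩, hp⟩
        obtain ⟨-, -, ⟨rfl, -⟩ | rfl | ⟨rfl, -⟩⟩ := he <;> simp [hN]
    · rintro ⟨q, l⟩ h
      simp only [Finset.mem_sigma, Finset.mem_filter, mem_pathFinset] at h
      exact (listWeight_cons A lam mu h.2).symm
  · rw [hN, Finset.sum_insert (by simp; omega), Finset.sum_insert (by simp), Finset.sum_singleton,
      add_assoc]

/-- The label of the vertex `(u - v, u + v)`. -/
def cell (A : Matrix (Fin n) (Fin n) K) (u v : ℕ) : K := entry A (n - v) (u + 1)

/-- The edge weights of the network in the coordinates `(x + y) / 2` and `(y - x) / 2`. -/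
def stepWeights (A : Matrix (Fin n) (Fin n) K) (lam mu : ℤ → K) : StepWeights K where
  h u v := lam (u + v + 1 - n)
  w u v := cell A u (v + 1) / cell A u v
  d u v := mu (u - v) * (cell A u (v + 1) / cell A u v)

theorem label_eq_cell (A : Matrix (Fin n) (Fin n) K) {p : ℤ × ℤ} (u v : ℕ)
    (h1 : p.1 = u - v) (h2 : p.2 = u + v) : label A p = cell A u v := by
  unfold label cell
  congr 1 <;> omega

/-- Both sides obey the first-step recursion. The conditions `x < y` and `-x < y` read `v > 0` and
`u > 0`; the bounds `u, v < n` of the diamond lose no path, since `j < n` and `v` never increases.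
-/
theorem sum_pathFinset_eq_pathSum (A : Matrix (Fin n) (Fin n) K) (lam mu : ℤ → K) {j : ℕ}
    (hj : j < n) {u v : ℕ} (hu : u < n) (hv : v < n) :
    ∑ l ∈ pathFinset n ((u : ℤ) - v, (u : ℤ) + v) ((j : ℤ), (j : ℤ)), listWeight A lam mu l =
      (stepWeights A lam mu).pathSum j u v := by
  have hdia : ∀ u v : ℕ, InDiamond n ((u : ℤ) - v, (u : ℤ) + v) ↔ u < n ∧ v < n := fun u v => by
    rw [inDiamond_iff]; simp only; omega
  induction v generalizing u with
  | zero =>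
    rw [StepWeights.pathSum_zero]
    have hd := (hdia u 0).2 ⟨hu, hv⟩
    simp only [Nat.cast_zero, sub_zero, add_zero] at hd ⊢
    split_ifs with h
    · subst h
      exact sum_pathFinset_self A lam mu hd
    · rw [sum_pathFinset_of_ne A lam mu (by simpa using h), if_neg, if_neg, if_neg]
      · simp
      all_goals
        rintro ⟨-, h1, h2⟩
        rw [inDiamond_iff] at h1
        simp only [Prod.mk.injEq] at h1 h2
        omega
  | succ v ih =>
    induction hk : n - u generalizing u with
    | zero => omega
    | succ k ihk =>
      have e1 : (((u : ℤ) - (v + 1 : ℕ)) + 1, ((u : ℤ) + (v + 1 : ℕ)) + 1) =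
          (((u + 1 : ℕ) : ℤ) - (v + 1 : ℕ), ((u + 1 : ℕ) : ℤ) + (v + 1 : ℕ)) := by
        ext <;> push_cast <;> ring
      have e2 : (((u : ℤ) - (v + 1 : ℕ)) + 2, ((u : ℤ) + (v + 1 : ℕ))) =
          (((u + 1 : ℕ) : ℤ) - v, ((u + 1 : ℕ) : ℤ) + v) := by
        ext <;> push_cast <;> ring
      have e3 : (((u : ℤ) - (v + 1 : ℕ)) + 1, ((u : ℤ) + (v + 1 : ℕ)) - 1) =
          ((u : ℤ) - v, (u : ℤ) + v) := by
        ext <;> push_cast <;> ring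
      have w1 : edgeWeight A lam mu ((u : ℤ) - (v + 1 : ℕ), (u : ℤ) + (v + 1 : ℕ))
          (((u : ℤ) - (v + 1 : ℕ)) + 1, ((u : ℤ) + (v + 1 : ℕ)) + 1) =
          (stepWeights A lam mu).h u (v + 1) := by
        simp only [edgeWeight, if_true, stepWeights]
      have w2 : edgeWeight A lam mu ((u : ℤ) - (v + 1 : ℕ), (u : ℤ) + (v + 1 : ℕ))
          (((u : ℤ) - (v + 1 : ℕ)) + 2, ((u : ℤ) + (v + 1 : ℕ))) =
          (stepWeights A lam mu).d u v := by
        rw [edgeWeight, if_neg (by simp), if_pos rfl, e3, label_eq_cell A u (v + 1) rfl rfl,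
          label_eq_cell A u v rfl rfl]
        simp only [stepWeights]
        congr 2
        push_cast; ring
      have w3 : edgeWeight A lam mu ((u : ℤ) - (v + 1 : ℕ), (u : ℤ) + (v + 1 : ℕ))
          (((u : ℤ) - (v + 1 : ℕ)) + 1, ((u : ℤ) + (v + 1 : ℕ)) - 1) =
          (stepWeights A lam mu).w u v := by
        rw [edgeWeight, if_neg, if_neg, e3, label_eq_cell A u (v + 1) rfl rfl,
          label_eq_cell A u v rfl rfl]
        · rfl
        · simp
        · simp only [Prod.mk.injEq, true_and]; omega
      rw [sum_pathFinset_of_ne A lam mu (fun h => by rw [Prod.mk.injEq] at h; omega)]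
      simp only [w1, w2, w3]
      simp only [Edge, e1, e2, e3, hdia]
      rw [StepWeights.pathSum_succ]
      congr 1
      · by_cases hu1 : u + 1 < n
        · rw [if_pos, if_pos, ihk hu1 (by omega), ih hu1 (by omega)]
          · exact ⟨⟨hu, hv⟩, ⟨hu1, by omega⟩, Or.inr (Or.inl trivial)⟩
          · exact ⟨⟨hu, hv⟩, ⟨hu1, hv⟩, Or.inl ⟨trivial, by push_cast; omega⟩⟩
        · rw [if_neg (by tauto), if_neg (by tauto), StepWeights.pathSum_of_lt _ (by omega),
            StepWeights.pathSum_of_lt _ (by omega)]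
          simp
      · by_cases hu0 : u = 0
        · rw [if_pos hu0, if_neg]
          rintro ⟨-, -, ⟨h, -⟩ | h | ⟨-, h⟩⟩
          · rw [Prod.mk.injEq] at h; omega
          · rw [Prod.mk.injEq] at h; omega
          · subst hu0; simp at h
        · rw [if_neg hu0, if_pos, ih hu (by omega)]
          exact ⟨⟨hu, hv⟩, ⟨hu, by omega⟩, Or.inr (Or.inr ⟨trivial, by push_cast; omega⟩)⟩

theorem det_paths_eq_pathDet (A : Matrix (Fin n) (Fin n) K) (lam mu : ℤ → K) :
    (Matrix.of fun i j : Fin n => ∑ p : Path n (-((i : ℕ) : ℤ), ((i : ℕ) : ℤ))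
      (((j : ℕ) : ℤ), ((j : ℕ) : ℤ)), listWeight A lam mu p.1).det =
      (stepWeights A lam mu).pathDet n := by
  rw [StepWeights.pathDet]
  congr 1
  ext i j
  have h := sum_pathFinset_eq_pathSum A lam mu j.2 (Nat.zero_lt_of_lt i.2) i.2
  simp only [Nat.cast_zero, zero_sub, zero_add] at h
  rw [Matrix.of_apply, Matrix.of_apply, ← h]
  exact (sum_pathFinset _ _ _).symm

theorem aHat_eq_det_paths (A : Matrix (Fin n) (Fin n) K) (lam mu : ℤ → K) :
    aHat A lam mu = (Matrix.of fun i j : Fin n => ∑ p : Path n (-((i : ℕ) : ℤ), ((i : ℕ) : ℤ))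
      (((j : ℕ) : ℤ), ((j : ℕ) : ℤ)), listWeight A lam mu p.1).det := by
  have habs : ∀ i : Fin n, (n : ℤ) - 1 - |((i : ℕ) : ℤ) - n + 1| = ((i : ℕ) : ℤ) := fun i => by
    rw [abs_of_nonpos (by omega)]; ring
  rw [aHat]
  congr 1
  ext i j
  have hl : leftVertex n (((Fin.castLE (by omega : n ≤ 2 * n - 1) i : Fin _) : ℕ) : ℤ) =
      (-((i : ℕ) : ℤ), ((i : ℕ) : ℤ)) := by
    simp only [leftVertex, Fin.val_castLE, habs]
  have hr : rightVertex n (((Fin.castLE (by omega : n ≤ 2 * n - 1) j : Fin _) : ℕ) : ℤ) =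
      (((j : ℕ) : ℤ), ((j : ℕ) : ℤ)) := by
    simp only [rightVertex, Fin.val_castLE, habs]
  rw [Matrix.submatrix_apply, thetaHat, Matrix.of_apply, Matrix.of_apply]
  refine (sum_pathFinset _ _ _).symm.trans ?_
  rw [hl, hr]
  exact sum_pathFinset _ _ _

/-! ### The solution of the `T`-system -/

theorem cell_ne_zero {A : Matrix (Fin n) (Fin n) K}
    (hA : ∀ i j : Fin n, 0 < (i : ℕ) → A i j ≠ 0) {u v : ℕ} (hu : u < n) (hv : v + 1 < n) :
    cell A u v ≠ 0 := by
  -- The matrix row is `n - v ≥ 2`, so its zero-based index is positive.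
  rw [cell, entry, dif_pos (by omega)]
  exact hA _ _ (by simp only; omega)

/-- Shifting by `(1, 1)`, `(1, 0)` and `(0, 1)` reproduces the neighbours in the `T`-system. The
ratios `cell A _ (v + 1) / cell A _ v` in `w` and `d` turn the label products at level `v` into
those at `v + 1`, leaving just `λ` and `μ`. -/
theorem T_eq_pathDet_mul_prod {A : Matrix (Fin n) (Fin n) K} {lam mu : ℤ → K}
    (hdef : IsDefined A lam mu) (hA : ∀ i j : Fin n, 0 < (i : ℕ) → A i j ≠ 0)
    (k u v : ℕ) (hu : u + k ≤ n) (hv : v + k ≤ n) :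
    T A lam mu k (u + v + k - n) (u - v) =
      ((stepWeights A lam mu).shift u v).pathDet k * ∏ i ∈ Finset.range k, cell A (u + i) v := by
  induction k using Nat.strong_induction_on generalizing u v with
  | _ k ih =>
    match k with
    | 0 => simp [T, StepWeights.pathDet_zero]
    | 1 =>
      rw [T, StepWeights.pathDet_one, Finset.prod_range_one, one_mul, cell]
      congr 1 <;> push_cast <;> omega
    | k + 2 =>
      have hs : ∀ a b, ((stepWeights A lam mu).shift u v).shift a b =
          (stepWeights A lam mu).shift (u + a) (v + b) := fun a b => by
        simp only [StepWeights.shift]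
        congr 1 <;> funext x y <;> congr 1 <;> omega
      have hC := ih k (by omega) (u + 1) (v + 1) (by omega) (by omega)
      have hTR := ih (k + 1) (by omega) (u + 1) (v + 1) (by omega) (by omega)
      have hBL := ih (k + 1) (by omega) u v (by omega) (by omega)
      have hBR := ih (k + 1) (by omega) (u + 1) v (by omega) (by omega)
      have hTL := ih (k + 1) (by omega) u (v + 1) (by omega) (by omega)
      have hne : ∀ i < k + 2, cell A (u + i) v ≠ 0 := fun i hi =>
        cell_ne_zero hA (by omega) (by omega)
      have key := ((stepWeights A lam mu).shift u v).pathDet_add_two_mul k (fun i hi => by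
        simp only [StepWeights.shift, stepWeights]
        exact div_ne_zero (cell_ne_zero hA (by omega) (by omega))
          (cell_ne_zero hA (by omega) (by omega)))
      simp only [hs, add_zero] at key
      have hden : T A lam mu k (u + v + (k + 2 : ℕ) - n) (u - v) ≠ 0 := by
        refine hdef k _ _ (by push_cast; omega) ?_
        rcases abs_cases ((u : ℤ) + v + (k + 2 : ℕ) - n) with h1 | h1 <;>
          rcases abs_cases ((u : ℤ) - v) with h2 | h2 <;> push_cast at * <;> omega
      have c1 : ((u + 1 : ℕ) : ℤ) + ((v + 1 : ℕ) : ℤ) + k - n = u + v + (k + 2 : ℕ) - n := by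
        push_cast; ring
      have c2 : ((u + 1 : ℕ) : ℤ) - ((v + 1 : ℕ) : ℤ) = u - v := by push_cast; ring
      have c3 : ((u + 1 : ℕ) : ℤ) + ((v + 1 : ℕ) : ℤ) + (k + 1 : ℕ) - n =
          u + v + (k + 2 : ℕ) - n + 1 := by push_cast; ring
      have c4 : (u : ℤ) + v + (k + 1 : ℕ) - n = u + v + (k + 2 : ℕ) - n - 1 := by push_cast; ring
      have c5 : ((u + 1 : ℕ) : ℤ) + v + (k + 1 : ℕ) - n = u + v + (k + 2 : ℕ) - n := by
        push_cast; ring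
      have c6 : ((u + 1 : ℕ) : ℤ) - v = u - v + 1 := by push_cast; ring
      have c7 : (u : ℤ) + (v + 1 : ℕ) + (k + 1 : ℕ) - n = u + v + (k + 2 : ℕ) - n := by
        push_cast; ring
      have c8 : (u : ℤ) - (v + 1 : ℕ) = u - v - 1 := by push_cast; ring
      rw [c1, c2] at hC
      rw [c3, c2] at hTR
      rw [c4] at hBL
      rw [c5, c6] at hBR
      rw [c7, c8] at hTL
      have w1 : ((stepWeights A lam mu).shift u v).h 0 (k + 1) = lam (u + v + (k + 2 : ℕ) - n) := by
        simp only [StepWeights.shift, stepWeights]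
        congr 1; push_cast; ring
      have w2 : ((stepWeights A lam mu).shift u v).w (k + 1) 0 =
          cell A (u + (k + 1)) (v + 1) / cell A (u + (k + 1)) v := by
        simp only [StepWeights.shift, stepWeights, zero_add, add_comm (k + 1) u]
      have w3 : ((stepWeights A lam mu).shift u v).d 0 0 =
          mu (u - v) * (cell A u (v + 1) / cell A u v) := by
        simp only [StepWeights.shift, stepWeights, zero_add]
      rw [w1, w2, w3] at key
      have p0 : ∏ i ∈ Finset.range (k + 2), cell A (u + i) v =
          cell A u v * (∏ i ∈ Finset.range k, cell A (u + 1 + i) v) * cell A (u + (k + 1)) v := by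
        rw [Finset.prod_range_succ, Finset.prod_range_succ', mul_comm (∏ i ∈ _, _)]
        simp only [add_zero, add_assoc, add_comm 1]
      have p1 : ∏ i ∈ Finset.range (k + 1), cell A (u + i) v =
          cell A u v * ∏ i ∈ Finset.range k, cell A (u + 1 + i) v := by
        rw [Finset.prod_range_succ', mul_comm (∏ i ∈ _, _)]
        simp only [add_zero, add_assoc, add_comm 1]
      have p2 : ∏ i ∈ Finset.range (k + 1), cell A (u + i) (v + 1) =
          cell A u (v + 1) * ∏ i ∈ Finset.range k, cell A (u + 1 + i) (v + 1) := by
        rw [Finset.prod_range_succ', mul_comm (∏ i ∈ _, _)]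
        simp only [add_zero, add_assoc, add_comm 1]
      have p3 : ∀ y, ∏ i ∈ Finset.range (k + 1), cell A (u + 1 + i) y =
          (∏ i ∈ Finset.range k, cell A (u + 1 + i) y) * cell A (u + (k + 1)) y := fun y => by
        rw [Finset.prod_range_succ, add_assoc u 1 k, add_comm 1 k]
      have n1 : cell A u v ≠ 0 := hne 0 (by omega)
      have n2 := hne (k + 1) (by omega)
      rw [T, div_eq_iff hden, hC, hTR, hBL, hBR, hTL, p0, p1, p2, p3, p3]
      -- With denominators cleared, the condensation identity differs from the `T`-system only by
      -- the label products common to all terms.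
      field_simp at key
      linear_combination -(∏ i ∈ Finset.range k, cell A (u + 1 + i) v) *
        (∏ i ∈ Finset.range k, cell A (u + 1 + i) (v + 1)) * key

theorem lambdaDet_eq_pathDet_mul_prod {A : Matrix (Fin n) (Fin n) K} {lam mu : ℤ → K}
    (hdef : IsDefined A lam mu) (hA : ∀ i j : Fin n, 0 < (i : ℕ) → A i j ≠ 0) :
    lambdaDet A lam mu =
      (stepWeights A lam mu).pathDet n * ∏ j : Fin n, entry A n ((j : ℕ) + 1) := by
  have h := T_eq_pathDet_mul_prod hdef hA n 0 0 (by omega) (by omega)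
  rw [Finset.prod_range] at h
  have hs : (stepWeights A lam mu).shift 0 0 = stepWeights A lam mu := rfl
  rw [hs] at h
  simpa [lambdaDet, cell] using h

end LambdaDet

end

theorem mainTheorem6 {K : Type*} [Field K] (n : ℕ) (A : Matrix (Fin n) (Fin n) K)
    (lam mu : ℤ → K)
    (hdef : LambdaDet.IsDefined A lam mu)
    (hA : ∀ i j : Fin n, 0 < (i : ℕ) → A i j ≠ 0) :
    LambdaDet.lambdaDet A lam mu =
        LambdaDet.aHat A lam mu * ∏ j : Fin n, LambdaDet.entry A n ((j : ℕ) + 1) ∧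
      LambdaDet.lambdaDet A lam mu =
        LambdaDet.partitionFunction A lam mu *
          ∏ j : Fin n, LambdaDet.entry A n ((j : ℕ) + 1) := by
  have h := LambdaDet.lambdaDet_eq_pathDet_mul_prod hdef hA
  constructor
  · rw [LambdaDet.aHat_eq_det_paths, LambdaDet.det_paths_eq_pathDet, h]
  · rw [← LambdaDet.det_eq_partitionFunction, LambdaDet.det_paths_eq_pathDet, h]
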